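/- Let $P$ be a finite poset. Let $$\mathcal O(P)=\{x\in[0,1]^P : x_i\le x_j \text{ whenever } i\le j\},\qquad \mathcal C(P)=\{x\in[0,1]^P : x_{p_1}+\dots+x_{p_s}\le 1 \text{ for every chain } p_1<\dots<p_s \text{ in } P\}$$ be its order polytope and its chain polytope, and let $\operatorname{gap}(P)$ be the number of facets of $\mathcal C(P)$ minus the number of facets of $\mathcal O(P)$. A saturated chain is a nonempty chain $c_1<\dots<c_k$ in $P$ in which each $c_{i+1}$ covers $c_i$. For $v\in P$ let $\operatorname{uc}(v)$ be the number of saturated chains whose smallest element is $v$ and whose largest element is a maximal element of $P$, and let $\operatorname{dc}(v)$ be the number of saturated chains whose largest element is $v$ and whose smallest element is a minimal element of $P$. The crossing number of $v$ is $(\operatorname{uc}(v)-1)(\operatorname{dc}(v)-1)$. Elements $a,b,c,d,e\in P$ form an X-shaped subposet with center $c$ if $a,b<c<d,e$, where $a,b$ are incomparable and $d,e$ are incomparable. The poset $P$ is an X-orchid if it has a saturated chain $c_1<\dots<c_k$ ($k\ge 1$) such that exactly two elements cover $c_k$, exactly two elements are covered by $c_1$, and every X-shaped subposet has some $c_i$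 as its center and, for every $j$, is again X-shaped with center $c_j$ after replacing $c_i$ by $c_j$. **Theorem.** The following are equivalent: 1. $P$ is an X-orchid. 2. $\operatorname{gap}(P)=1$. 3. $P$ has a saturated chain all of whose elements have crossing number one, and all elements of $P$ outside this chain have crossing number zero. -/

import Mathlib

/-- The order polytope of a finite poset `P`, as a subset of `ℝ^P`. -/
def orderPolytope (P : Type*) [PartialOrder P] : Set (P → ℝ) :=
  {x | (∀ i, 0 ≤ x i ∧ x i ≤ 1) ∧ ∀ i j, i ≤ j → x i ≤ x j}

/-- The chain polytope of a finite poset `P`, as a subset of `ℝ^P`: the sum of the coordinates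
over every chain (finite set of pairwise comparable elements) is at most `1`. -/
def chainPolytope (P : Type*) [PartialOrder P] : Set (P → ℝ) :=
  {x | (∀ i, 0 ≤ x i ∧ x i ≤ 1) ∧
    ∀ s : Finset P, IsChain (· ≤ ·) (s : Set P) → ∑ p ∈ s, x p ≤ 1}

/-- `F` is a facet of the polytope `K ⊆ ℝ^P`: a nonempty face (the set of maximizers over `K` of
some linear functional) whose dimension is one less than that of `K`. The dimension of a
nonempty set is the dimension of the direction space of its affine hull. -/
def IsFacet {P : Type*} (K F : Set (P → ℝ)) : Prop :=
  F.Nonempty ∧ IsExposed ℝ K F ∧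
    Module.finrank ℝ (vectorSpan ℝ F) + 1 = Module.finrank ℝ (vectorSpan ℝ K)

/-- The number of facets of a polytope. -/
noncomputable def facetCount {P : Type*} (K : Set (P → ℝ)) : ℕ :=
  {F : Set (P → ℝ) | IsFacet K F}.ncard

/-- The gap of a finite poset: the number of facets of its chain polytope minus
the number of facets of its order polytope. -/
noncomputable def gap (P : Type*) [PartialOrder P] : ℤ :=
  (facetCount (chainPolytope P) : ℤ) - (facetCount (orderPolytope P) : ℤ)

/-- A (nonempty) saturated chain `c₁ ⋖ c₂ ⋖ ⋯ ⋖ cₖ`, listed in increasing order. -/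
def IsSaturatedChain {P : Type*} [PartialOrder P] (l : List P) : Prop :=
  l ≠ [] ∧ l.IsChain (· ⋖ ·)

/-- The number of saturated chains whose smallest element is `v` and
whose largest element is a maximal element of `P`. -/
noncomputable def upChains {P : Type*} [PartialOrder P] (v : P) : ℕ :=
  {l : List P | IsSaturatedChain l ∧ l.head? = some v ∧
    ∃ m, l.getLast? = some m ∧ IsMax m}.ncard

/-- The number of saturated chains whose largest element is `v` and
whose smallest element is a minimal element of `P`. -/
noncomputable def downChains {P : Type*} [PartialOrder P] (v : P) : ℕ :=
  {l : List P | IsSaturatedChain l ∧ l.getLast? = some v ∧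
    ∃ m, l.head? = some m ∧ IsMin m}.ncard

/-- The crossing number of an element. -/
noncomputable def crossingNumber {P : Type*} [PartialOrder P] (v : P) : ℤ :=
  ((upChains v : ℤ) - 1) * ((downChains v : ℤ) - 1)

/-- The elements `a, b, c, d, e` form an X-shaped subposet with center `c`:
`a, b < c < d, e`, with `a, b` incomparable and `d, e` incomparable (so all five are distinct). -/
structure IsXShaped {P : Type*} [PartialOrder P] (a b c d e : P) : Prop where
  lt_left : a < c
  lt_right : b < c
  gt_left : c < d
  gt_right : c < e
  not_le_lower : ¬ a ≤ b
  not_ge_lower : ¬ b ≤ a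
  not_le_upper : ¬ d ≤ e
  not_ge_upper : ¬ e ≤ d

/-- `P` is an X-orchid: it has a saturated chain `c₁ ⋖ ⋯ ⋖ cₖ`, `k ≥ 1`, such that exactly two
elements cover `cₖ`, exactly two elements are covered by `c₁`, and every X-shaped subposet has
some `cᵢ` as its center and stays X-shaped, with center `cⱼ`, when `cᵢ` is replaced by any `cⱼ`. -/
def IsXOrchid (P : Type*) [PartialOrder P] : Prop :=
  ∃ (l : List P) (h : l ≠ []), IsSaturatedChain l ∧
    {u : P | l.getLast h ⋖ u}.ncard = 2 ∧
    {d : P | d ⋖ l.head h}.ncard = 2 ∧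
    ∀ a b c d e : P, IsXShaped a b c d e → c ∈ l ∧ ∀ c' ∈ l, IsXShaped a b c' d e

/-! The facets of a full-dimensional polytope correspond to the inequalities of an irredundant
description (`facetCount_polyhedron`). For the order polytope these come from cover relations,
minimal elements and maximal elements; for the chain polytope, from elements and maximal chains.
Counting maximal chains with the recursion uc(v) = sum of uc(w) over the upper covers w of v turns
the gap into the sum over v of (uc(v) - 1)(ld(v) - 1), where ld(v) is the number of lower covers, or
1 if v is minimal (`gap_eq_sum`). All summands are nonnegative.

Call v crossing if uc(v) and dc(v) are both at least 2; these are exactly the centers of X-shaped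
subposets. If the gap is 1, a single v₀ contributes, with uc = ld = 2. Any other crossing element
has a unique lower cover, again crossing, so descent ends at v₀. Since uc decreases upwards, uc = 2
on all crossing elements; dc = 2 is carried up from v₀; and a branching would force uc ≥ 4 below it.
So the crossing elements form a saturated chain. Conversely, on a chain with uc = dc = 2 only the
lowest element has two lower covers, so the gap is 1.

For orchids, constancy of uc and dc along the chain means that no element branches off between its
ends, which is what exchangeability of the centers says. -/

open Filter Topology

/-- A point satisfying finitely many inequalities strictly still does so after a small move
in any direction. -/
theorem exists_pos_forall_add_mul_lt {ι : Type*} [Finite ι] (u w b : ι → ℝ)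
    (h : ∀ i, u i < b i) : ∃ ε > 0, ∀ i, u i + ε * w i < b i := by
  have key : ∀ᶠ ε in 𝓝[>] (0 : ℝ), ∀ i, u i + ε * w i < b i := by
    refine eventually_all.2 fun i => ?_
    have hc : Tendsto (fun ε : ℝ => u i + ε * w i) (𝓝 0) (𝓝 (u i + 0 * w i)) :=
      Continuous.tendsto (by fun_prop) 0
    rw [zero_mul, add_zero] at hc
    exact (hc.eventually_lt_const (h i)).filter_mono nhdsWithin_le_nhds
  obtain ⟨ε, h1, h2⟩ := (key.and self_mem_nhdsWithin).exists
  exact ⟨ε, h2, h1⟩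

/-! ### Facets of polyhedra with irredundant descriptions -/

section Polyhedron

variable {P ι : Type*} (f : ι → (P → ℝ) →ₗ[ℝ] ℝ) (b : ι → ℝ)

/-- The polyhedron cut out by the inequalities `f i x ≤ b i`. -/
def polyhedron : Set (P → ℝ) := {x | ∀ i, f i x ≤ b i}

variable {f b}

theorem vectorSpan_polyhedron_eq_top [Finite ι] {x₀ : P → ℝ} (h₀ : ∀ i, f i x₀ < b i) :
    vectorSpan ℝ (polyhedron f b) = ⊤ := by
  refine eq_top_iff.2 fun v _ => ?_
  obtain ⟨ε, hε, h⟩ := exists_pos_forall_add_mul_lt (fun i => f i x₀) (fun i => f i v) b h₀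
  have h1 : x₀ + ε • v ∈ polyhedron f b := fun i => by simpa using (h i).le
  have h2 := vsub_mem_vectorSpan ℝ h1 (fun i => (h₀ i).le : x₀ ∈ polyhedron f b)
  simp only [vsub_eq_sub, add_sub_cancel_left] at h2
  exact (Submodule.smul_mem_iff _ hε.ne').1 h2

/-- A direction in the kernel of `f i` keeps inequality `i` tight, and a small step from `y` keeps
the others strict. -/
theorem vectorSpan_tight_eq_ker [Finite ι] {i : ι} {y : P → ℝ} (hy : f i y = b i)
    (hlt : ∀ j, j ≠ i → f j y < b j) :
    vectorSpan ℝ {x ∈ polyhedron f b | f i x = b i} = LinearMap.ker (f i) := by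
  have hyK : y ∈ {x ∈ polyhedron f b | f i x = b i} := by
    refine ⟨fun j => ?_, hy⟩
    by_cases hj : j = i
    · subst hj; exact hy.le
    · exact (hlt j hj).le
  apply le_antisymm
  · rw [vectorSpan_def, Submodule.span_le]
    rintro _ ⟨p, hp, q, hq, rfl⟩
    simp [hp.2, hq.2]
  · intro v hv
    rw [LinearMap.mem_ker] at hv
    obtain ⟨ε, hε, h⟩ := exists_pos_forall_add_mul_lt (ι := {j // j ≠ i}) (fun j => f j y)
      (fun j => f j v) (fun j => b j) (fun j => hlt j j.2)
    have h1 : y + ε • v ∈ {x ∈ polyhedron f b | f i x = b i} := by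
      have hi : f i (y + ε • v) = b i := by simp [hv, hy]
      refine ⟨fun j => ?_, hi⟩
      by_cases hj : j = i
      · subst hj; exact hi.le
      · simpa using (h ⟨j, hj⟩).le
    have h2 := vsub_mem_vectorSpan ℝ h1 hyK
    simp only [vsub_eq_sub, add_sub_cancel_left] at h2
    exact (Submodule.smul_mem_iff _ hε.ne').1 h2

/-- A linear functional maximized over a polyhedron at a strictly feasible point vanishes. -/
theorem eq_zero_of_isMax_of_strict [Finite ι] {l : (P → ℝ) →ₗ[ℝ] ℝ} {z : P → ℝ}
    (hz : ∀ i, f i z < b i) (hl : ∀ y ∈ polyhedron f b, l y ≤ l z) : l = 0 := by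
  have key : ∀ v, l v ≤ 0 := fun v => by
    obtain ⟨ε, hε, h⟩ := exists_pos_forall_add_mul_lt (fun i => f i z) (fun i => f i v) b hz
    have := hl (z + ε • v) fun i => by simpa using (h i).le
    simp only [map_add, map_smul, smul_eq_mul] at this
    by_contra! hc
    nlinarith [mul_pos hε hc]
  refine LinearMap.ext fun v => le_antisymm (key v) ?_
  have := key (-v)
  simpa using this

/-- If no defining inequality is tight on all of a convex subset of a polyhedron, then
the subset has a strictly feasible point. -/
theorem exists_strict_mem_of_convex [Finite ι] {F : Set (P → ℝ)} (hF : Convex ℝ F)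
    (hFK : F ⊆ polyhedron f b) (hne : F.Nonempty) (h : ∀ i, ∃ y ∈ F, f i y < b i) :
    ∃ z ∈ F, ∀ i, f i z < b i := by
  classical
  have := Fintype.ofFinite ι
  suffices H : ∀ s : Finset ι, ∃ z ∈ F, ∀ i ∈ s, f i z < b i by
    obtain ⟨z, hz, h⟩ := H Finset.univ
    exact ⟨z, hz, fun i => h i (Finset.mem_univ i)⟩
  intro s
  induction s using Finset.induction_on with
  | empty => exact ⟨hne.some, hne.some_mem, by simp⟩
  | insert i s _ ih =>
    obtain ⟨z, hz, hzs⟩ := ih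
    obtain ⟨y, hy, hyi⟩ := h i
    -- A midpoint satisfies strictly every inequality that is strict at either endpoint.
    refine ⟨(1 / 2 : ℝ) • z + (1 / 2 : ℝ) • y,
      hF hz hy (by norm_num) (by norm_num) (by norm_num), fun j hj => ?_⟩
    simp only [map_add, map_smul, smul_eq_mul]
    have h1 := hFK hz j
    have h2 := hFK hy j
    rcases Finset.mem_insert.1 hj with rfl | hj
    · linarith
    · linarith [hzs j hj]

theorem isFacet_tight [Finite P] [Finite ι] {x₀ : P → ℝ} (h₀ : ∀ i, f i x₀ < b i)
    {i : ι} {y : P → ℝ} (hy : f i y = b i) (hlt : ∀ j, j ≠ i → f j y < b j) :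
    IsFacet (polyhedron f b) {x ∈ polyhedron f b | f i x = b i} := by
  have := Fintype.ofFinite P
  have hyK : y ∈ polyhedron f b := fun j => by
    by_cases hj : j = i
    · subst hj; exact hy.le
    · exact (hlt j hj).le
  refine ⟨⟨y, hyK, hy⟩, fun _ => ⟨LinearMap.toContinuousLinearMap (f i), ?_⟩, ?_⟩
  · ext x
    refine and_congr_right fun hx => ⟨fun h z hz => ?_, fun h => ?_⟩
    · simpa [h] using hz i
    · exact le_antisymm (hx i) (by simpa [hy] using h y hyK)
  · rw [vectorSpan_polyhedron_eq_top h₀, vectorSpan_tight_eq_ker hy hlt, finrank_top]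
    refine Module.Dual.finrank_ker_add_one_of_ne_zero (f := f i) fun h => ?_
    have := h₀ i
    rw [← hy, h] at this
    simp at this

/-- Some inequality is tight on all of `F`, or the exposing functional would attain its maximum at a
strictly feasible point and vanish. By dimension `F` spans the kernel of that `f i`, so the
functional is a positive multiple of `f i` and has the same maximizers. -/
theorem exists_eq_tight_of_isFacet [Finite P] [Finite ι] {x₀ : P → ℝ}
    (h₀ : ∀ i, f i x₀ < b i) {y : ι → P → ℝ} (hy : ∀ i, f i (y i) = b i)
    (hlt : ∀ i j, j ≠ i → f j (y i) < b j) {F : Set (P → ℝ)} (hF : IsFacet (polyhedron f b) F) :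
    ∃ i, {x ∈ polyhedron f b | f i x = b i} = F := by
  have := Fintype.ofFinite P
  obtain ⟨hne, hexp, hdim⟩ := hF
  have hconv : Convex ℝ (polyhedron f b) := by
    intro x hx z hz s t hs ht hst i
    simp only [map_add, map_smul, smul_eq_mul]
    calc s * f i x + t * f i z ≤ s * b i + t * b i :=
          add_le_add (mul_le_mul_of_nonneg_left (hx i) hs) (mul_le_mul_of_nonneg_left (hz i) ht)
      _ = b i := by rw [← add_mul, hst, one_mul]
  have hFconv : Convex ℝ F := hexp.convex hconv
  have hFK : F ⊆ polyhedron f b := hexp.subset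
  obtain ⟨l, hl⟩ := hexp hne
  have hl0 : (l : (P → ℝ) →ₗ[ℝ] ℝ) ≠ 0 := fun h0 => by
    have h0' : ∀ v, l v = 0 := fun v => LinearMap.congr_fun h0 v
    have : F = polyhedron f b := by rw [hl]; simp [h0']
    rw [this] at hdim
    omega
  have htight : ∃ i, ∀ x ∈ F, f i x = b i := by
    by_contra! hcon
    obtain ⟨z, hzF, hz⟩ := exists_strict_mem_of_convex hFconv hFK hne fun i => by
      obtain ⟨x, hx, hxi⟩ := hcon i
      exact ⟨x, hx, lt_of_le_of_ne (hFK hx i) hxi⟩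
    rw [hl] at hzF
    exact hl0 (eq_zero_of_isMax_of_strict (l := (l : (P → ℝ) →ₗ[ℝ] ℝ)) hz hzF.2)
  obtain ⟨i, hi⟩ := htight
  refine ⟨i, ?_⟩
  have hspan : vectorSpan ℝ F = LinearMap.ker (f i) := by
    apply Submodule.eq_of_le_of_finrank_eq
    · rw [← vectorSpan_tight_eq_ker (hy i) (hlt i)]
      exact vectorSpan_mono ℝ fun x hx => ⟨hFK hx, hi x hx⟩
    · have h2 := (isFacet_tight h₀ (hy i) (hlt i)).2.2
      rw [vectorSpan_tight_eq_ker (hy i) (hlt i)] at h2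
      omega
  have hker : LinearMap.ker (f i) ≤ LinearMap.ker (l : (P → ℝ) →ₗ[ℝ] ℝ) := by
    rw [← hspan, vectorSpan_def, Submodule.span_le]
    rintro _ ⟨p, hp, q, hq, rfl⟩
    rw [hl] at hp hq
    simpa [sub_eq_zero] using le_antisymm (hq.2 p hp.1) (hp.2 q hq.1)
  obtain ⟨x₁, hx₁⟩ := hne
  have hpos : 0 < f i x₁ - f i x₀ := by rw [hi x₁ hx₁]; linarith [h₀ i]
  obtain ⟨c, hc⟩ : ∃ c : ℝ, ∀ v, l v = c * f i v := by
    -- The factor is read off along `x₁ - x₀`, a direction transverse to the kernel of `f i`.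
    refine ⟨l (x₁ - x₀) / (f i x₁ - f i x₀), fun v => ?_⟩
    have : v - (f i v / (f i x₁ - f i x₀)) • (x₁ - x₀) ∈ LinearMap.ker (f i) := by
      simp [hpos.ne']
    have := hker this
    simp only [LinearMap.mem_ker, map_sub, map_smul, ContinuousLinearMap.coe_coe,
      smul_eq_mul, sub_eq_zero] at this
    rw [this, map_sub]
    ring
  have hc0 : 0 < c := by
    have h1 : l x₀ ≤ l x₁ := by
      rw [hl] at hx₁
      exact hx₁.2 x₀ fun i => (h₀ i).le
    rw [hc, hc] at h1
    refine lt_of_le_of_ne ?_ ?_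
    · by_contra! hneg
      nlinarith
    · rintro rfl
      exact hl0 (LinearMap.ext fun v => by simpa using hc v)
  rw [hl]
  ext x
  refine and_congr_right fun hx => ⟨fun h z hz => ?_, fun h => ?_⟩
  · rw [hc, hc, h]
    exact mul_le_mul_of_nonneg_left (hz i) hc0.le
  · have := h x₁ (hFK hx₁)
    rw [hc, hc, hi x₁ hx₁] at this
    exact le_antisymm (hx i) (le_of_mul_le_mul_left this hc0)

/-- The number of facets of a full-dimensional polyhedron equals the number of inequalities in
an irredundant description of it. -/
theorem facetCount_polyhedron [Finite P] [Finite ι] {x₀ : P → ℝ}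
    (h₀ : ∀ i, f i x₀ < b i) {y : ι → P → ℝ} (hy : ∀ i, f i (y i) = b i)
    (hlt : ∀ i j, j ≠ i → f j (y i) < b j) : facetCount (polyhedron f b) = Nat.card ι := by
  have himg : {F | IsFacet (polyhedron f b) F} =
      Set.range fun i => {x ∈ polyhedron f b | f i x = b i} := by
    ext F
    refine ⟨fun hF => exists_eq_tight_of_isFacet h₀ hy hlt hF, ?_⟩
    rintro ⟨i, rfl⟩
    exact isFacet_tight h₀ (hy i) (hlt i)
  rw [facetCount, himg, ← Nat.card_coe_set_eq, Nat.card_range_of_injective]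
  intro i j hij
  by_contra hne
  have hmem : y i ∈ {x ∈ polyhedron f b | f i x = b i} := by
    refine ⟨fun k => ?_, hy i⟩
    by_cases hk : k = i
    · subst hk; exact (hy k).le
    · exact (hlt i k hk).le
  have hmem' : y i ∈ {x ∈ polyhedron f b | f j x = b j} := by
    have h := hij
    dsimp only at h
    rwa [h] at hmem
  exact (hlt i j (Ne.symm hne)).ne hmem'.2

end Polyhedron

/-! ### Height functions with values in the open unit interval -/

section ScaledHeight

variable {P : Type*}

/-- The height function of a reflexive relation, scaled into the open unit interval. -/
noncomputable def scaledHeight (r : P → P → Prop) (k : P) : ℝ :=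
  ({z | r z k}.ncard : ℝ) / (Nat.card P + 1)

theorem scaledHeight_pos [Finite P] {r : P → P → Prop} {k : P} (h : r k k) :
    0 < scaledHeight r k := by
  have : 0 < {z | r z k}.ncard := (Set.ncard_pos (Set.toFinite _)).2 ⟨k, h⟩
  unfold scaledHeight
  positivity

theorem scaledHeight_lt_one [Finite P] (r : P → P → Prop) (k : P) : scaledHeight r k < 1 := by
  have : {z | r z k}.ncard ≤ Nat.card P := Set.ncard_le_card _
  unfold scaledHeight
  rw [div_lt_one (by positivity)]
  exact_mod_cast Nat.lt_succ_of_le this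

theorem scaledHeight_lt [Finite P] {r : P → P → Prop} (hr : ∀ a b c, r a b → r b c → r a c)
    {k l : P} (hl : r l l) (hkl : r k l) (hlk : ¬ r l k) :
    scaledHeight r k < scaledHeight r l := by
  have : {z | r z k}.ncard < {z | r z l}.ncard :=
    Set.ncard_lt_ncard ⟨fun z hz => hr z k l hz hkl, fun h => hlk (h hl)⟩ (Set.toFinite _)
  exact div_lt_div_of_pos_right (by exact_mod_cast this) (by positivity)

end ScaledHeight

/-! ### Facets of the order polytope -/

section FacetCounts

variable {P : Type*} [PartialOrder P]

/-- The index set for the facets of the order polytope. -/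
abbrev OrderFacetIndex (P : Type*) [PartialOrder P] : Type _ :=
  {p : P × P // p.1 ⋖ p.2} ⊕ {m : P // IsMin m} ⊕ {m : P // IsMax m}

/-- The linear functionals describing the order polytope. -/
def orderFunctional : OrderFacetIndex P → (P → ℝ) →ₗ[ℝ] ℝ
  | .inl p => (LinearMap.proj p.1.1 : (P → ℝ) →ₗ[ℝ] ℝ) - LinearMap.proj p.1.2
  | .inr (.inl m) => -LinearMap.proj m.1
  | .inr (.inr m) => LinearMap.proj m.1

/-- The right-hand sides of the inequalities describing the order polytope. -/
def orderBound : OrderFacetIndex P → ℝ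
  | .inl _ => 0
  | .inr (.inl _) => 0
  | .inr (.inr _) => 1

theorem monotone_of_covBy [Finite P] {x : P → ℝ} (h : ∀ i j, i ⋖ j → x i ≤ x j) {i j : P}
    (hij : i ≤ j) : x i ≤ x j := by
  induction i using WellFoundedGT.induction with
  | ind i ih =>
    rcases hij.eq_or_lt with rfl | hlt
    · exact le_rfl
    · obtain ⟨w, hw, hwj⟩ := exists_covBy_le_of_lt hlt
      exact (h i w hw).trans (ih w hw.lt hwj)

theorem exists_isMin_le [Finite P] (v : P) : ∃ m ≤ v, IsMin m := by
  obtain ⟨m, hm, h⟩ := Set.Finite.exists_le_minimal (Set.toFinite (Set.univ : Set P))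
    (Set.mem_univ v)
  exact ⟨m, hm, minimal_true.1 (by simpa using h)⟩

theorem exists_le_isMax [Finite P] (v : P) : ∃ m, v ≤ m ∧ IsMax m := by
  obtain ⟨m, hm, h⟩ := exists_isMin_le (OrderDual.toDual v)
  exact ⟨OrderDual.ofDual m, hm, h⟩

theorem orderPolytope_eq_polyhedron [Finite P] :
    orderPolytope P = polyhedron orderFunctional orderBound := by
  ext x
  constructor
  · rintro ⟨h1, h2⟩ (⟨⟨i, j⟩, hij⟩ | m | m)
    · simpa [orderFunctional, orderBound] using h2 i j hij.le
    · simpa [orderFunctional, orderBound] using (h1 m).1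
    · simpa [orderFunctional, orderBound] using (h1 m).2
  · intro h
    have hmono : ∀ i j, i ≤ j → x i ≤ x j := fun i j =>
      monotone_of_covBy fun i j hij => by
        simpa [orderFunctional, orderBound] using h (.inl ⟨(i, j), hij⟩)
    refine ⟨fun i => ⟨?_, ?_⟩, hmono⟩
    · obtain ⟨m, hmi, hm⟩ := exists_isMin_le i
      refine le_trans ?_ (hmono m i hmi)
      simpa [orderFunctional, orderBound] using h (.inr (.inl ⟨m, hm⟩))
    · obtain ⟨m, hmi, hm⟩ := exists_le_isMax i
      refine (hmono i m hmi).trans ?_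
      simpa [orderFunctional, orderBound] using h (.inr (.inr ⟨m, hm⟩))

theorem scaledHeight_le_strictMono [Finite P] {k l : P} (h : k < l) :
    scaledHeight (· ≤ ·) k < scaledHeight (· ≤ ·) l :=
  scaledHeight_lt (r := (· ≤ ·)) (fun _ _ _ hab hbc => le_trans hab hbc) (le_refl l) h.le
    (not_le_of_gt h)

/-- The order obtained from `≤` by also imposing `j ≤ i`. -/
def identify (i j k l : P) : Prop := k ≤ l ∨ k ≤ j ∧ i ≤ l

theorem identify_trans (i j : P) (a b c : P) (h1 : identify i j a b) (h2 : identify i j b c) :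
    identify i j a c := by
  unfold identify at *
  rcases h1 with h1 | h1 <;> rcases h2 with h2 | h2
  · exact .inl (h1.trans h2)
  · exact .inr ⟨h1.trans h2.1, h2.2⟩
  · exact .inr ⟨h1.1, h1.2.trans h2⟩
  · exact .inr ⟨h1.1, h2.2⟩

theorem scaledHeight_identify_eq {i j : P} (hij : i ⋖ j) :
    scaledHeight (identify i j) i = scaledHeight (identify i j) j := by
  unfold scaledHeight
  congr 3
  ext z
  exact ⟨fun h => identify_trans i j _ _ _ h (.inl hij.le),
    fun h => identify_trans i j _ _ _ h (.inr ⟨le_rfl, le_rfl⟩)⟩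

/-- Imposing `j ≤ i` can only identify `k < l` if `i ≤ k < l ≤ j`, and nothing lies strictly between
`i` and `j`. -/
theorem scaledHeight_identify_lt [Finite P] {i j k l : P} (hij : i ⋖ j) (hkl : k < l)
    (hne : ¬ (k = i ∧ l = j)) :
    scaledHeight (identify i j) k < scaledHeight (identify i j) l := by
  refine scaledHeight_lt (identify_trans i j) (.inl le_rfl) (.inl hkl.le) ?_
  rintro (h | ⟨h1, h2⟩)
  · exact hkl.not_ge h
  · rcases hij.eq_or_eq h2 (hkl.le.trans h1) with rfl | rfl
    · rcases hij.eq_or_eq hkl.le h1 with rfl | rfl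
      · exact hkl.ne rfl
      · exact hne ⟨rfl, rfl⟩
    · exact hkl.not_ge h1

open Classical in
/-- A point of the order polytope at which exactly one given inequality is tight. -/
noncomputable def orderWitness : OrderFacetIndex P → P → ℝ
  | .inl p => scaledHeight (identify p.1.1 p.1.2)
  | .inr (.inl m) => Function.update (scaledHeight (· ≤ ·)) m.1 0
  | .inr (.inr m) => Function.update (scaledHeight (· ≤ ·)) m.1 1

theorem facetCount_orderPolytope [Finite P] :
    facetCount (orderPolytope P) = Nat.card (OrderFacetIndex P) := by
  classical
  rw [orderPolytope_eq_polyhedron]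
  have hpos : ∀ k : P, 0 < scaledHeight (· ≤ ·) k := fun k => scaledHeight_pos le_rfl
  have hone : ∀ k : P, scaledHeight (· ≤ ·) k < 1 := scaledHeight_lt_one _
  refine facetCount_polyhedron (x₀ := scaledHeight (· ≤ ·)) (y := orderWitness) ?_ ?_ ?_
  · rintro (⟨⟨i, j⟩, hij⟩ | m | m)
    · simpa [orderFunctional, orderBound] using scaledHeight_le_strictMono hij.lt
    · simpa [orderFunctional, orderBound] using hpos m
    · simpa [orderFunctional, orderBound] using hone m
  · rintro (⟨⟨i, j⟩, hij⟩ | m | m)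
    · simpa [orderFunctional, orderBound, orderWitness, sub_eq_zero] using
        scaledHeight_identify_eq hij
    · simp [orderFunctional, orderBound, orderWitness]
    · simp [orderFunctional, orderBound, orderWitness]
  · rintro (⟨⟨i, j⟩, hij⟩ | ⟨m, hm⟩ | ⟨m, hm⟩) (⟨⟨k, l⟩, hkl⟩ | ⟨n, hn⟩ | ⟨n, hn⟩) hne <;>
      simp only [orderFunctional, orderBound, orderWitness, LinearMap.sub_apply,
        LinearMap.neg_apply, LinearMap.proj_apply, sub_neg, neg_lt_zero]
    · exact scaledHeight_identify_lt hij hkl.lt fun h => hne (by obtain ⟨rfl, rfl⟩ := h; rfl)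
    · exact scaledHeight_pos (.inl le_rfl)
    · exact scaledHeight_lt_one _ _
    · have hlm : l ≠ m := by rintro rfl; exact hm.not_lt hkl.lt
      rw [Function.update_of_ne hlm]
      by_cases hk : k = m
      · subst hk; simpa using hpos l
      · rw [Function.update_of_ne hk]; exact scaledHeight_le_strictMono hkl.lt
    · have hnm : n ≠ m := by rintro rfl; exact hne rfl
      rw [Function.update_of_ne hnm]; exact hpos n
    · by_cases hk : n = m
      · subst hk; simp
      · rw [Function.update_of_ne hk]; exact hone n
    · have hkm : k ≠ m := by rintro rfl; exact hm.not_lt hkl.lt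
      rw [Function.update_of_ne hkm]
      by_cases hl : l = m
      · subst hl; simpa using hone k
      · rw [Function.update_of_ne hl]; exact scaledHeight_le_strictMono hkl.lt
    · by_cases hk : n = m
      · subst hk; simp
      · rw [Function.update_of_ne hk]; exact hpos n
    · have hnm : n ≠ m := by rintro rfl; exact hne rfl
      rw [Function.update_of_ne hnm]; exact hone n

/-! ### Facets of the chain polytope -/

/-- The maximal chains of `P`, as finsets. -/
abbrev MaxChain (P : Type*) [PartialOrder P] : Type _ :=
  {s : Finset P // IsMaxChain (· ≤ ·) (s : Set P)}

/-- The linear functionals describing the chain polytope. -/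
def chainFunctional : P ⊕ MaxChain P → (P → ℝ) →ₗ[ℝ] ℝ
  | .inl p => -LinearMap.proj p
  | .inr s => ∑ p ∈ s.1, LinearMap.proj p

/-- The right-hand sides of the inequalities describing the chain polytope. -/
def chainBound : P ⊕ MaxChain P → ℝ
  | .inl _ => 0
  | .inr _ => 1

theorem exists_maxChain_superset [Finite P] {s : Finset P}
    (hs : IsChain (· ≤ ·) (s : Set P)) : ∃ t : MaxChain P, s ⊆ t.1 := by
  classical
  obtain ⟨M, hM, hsM⟩ := hs.exists_maxChain
  refine ⟨⟨(Set.toFinite M).toFinset, by simpa using hM⟩, fun x hx => ?_⟩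
  simpa using hsM hx

theorem chainPolytope_eq_polyhedron [Finite P] :
    chainPolytope P = polyhedron chainFunctional chainBound := by
  ext x
  constructor
  · rintro ⟨h1, h2⟩ (p | s)
    · simpa [chainFunctional, chainBound] using (h1 p).1
    · simpa [chainFunctional, chainBound] using h2 s.1 s.2.isChain
  · intro h
    have hnn : ∀ i, 0 ≤ x i := fun i => by
      simpa [chainFunctional, chainBound] using h (.inl i)
    have hsum : ∀ s : Finset P, IsChain (· ≤ ·) (s : Set P) → ∑ p ∈ s, x p ≤ 1 := fun s hs => by
      obtain ⟨t, hst⟩ := exists_maxChain_superset hs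
      refine (Finset.sum_le_sum_of_subset_of_nonneg hst fun i _ _ => hnn i).trans ?_
      simpa [chainFunctional, chainBound] using h (.inr t)
    exact ⟨fun i => ⟨hnn i, by simpa using hsum {i} (by simp)⟩, hsum⟩

theorem MaxChain.nonempty [Nonempty P] (s : MaxChain P) : s.1.Nonempty := by
  simpa using s.2.nonempty_iff.1 ‹_›

theorem MaxChain.eq_of_subset {s t : MaxChain P} (h : s.1 ⊆ t.1) : s = t :=
  Subtype.ext (Finset.coe_injective (s.2.2 t.2.isChain h))

open Classical in
/-- A point of the chain polytope at which exactly one given inequality is tight. -/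
noncomputable def chainWitness : P ⊕ MaxChain P → P → ℝ
  | .inl p => Function.update (fun _ => ((Nat.card P : ℝ) + 1)⁻¹) p 0
  | .inr s => fun q => if q ∈ s.1 then (s.1.card : ℝ)⁻¹ else ((Nat.card P : ℝ) + 1)⁻¹ ^ 2

theorem facetCount_chainPolytope [Finite P] [Nonempty P] :
    facetCount (chainPolytope P) = Nat.card P + Nat.card (MaxChain P) := by
  classical
  have := Fintype.ofFinite P
  have hcard : ∀ s : Finset P, (s.card : ℝ) ≤ Nat.card P := fun s => by
    rw [Nat.card_eq_fintype_card]; exact_mod_cast s.card_le_univ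
  have hsmall : ∀ s : Finset P, (s.card : ℝ) * ((Nat.card P : ℝ) + 1)⁻¹ < 1 := fun s => by
    rw [← div_eq_mul_inv, div_lt_one (by positivity)]
    linarith [hcard s]
  rw [chainPolytope_eq_polyhedron, ← Nat.card_sum]
  refine facetCount_polyhedron (x₀ := fun _ => ((Nat.card P : ℝ) + 1)⁻¹) (y := chainWitness)
    ?_ ?_ ?_
  · rintro (p | s)
    · simp only [chainFunctional, chainBound, LinearMap.neg_apply, LinearMap.proj_apply, neg_lt_zero]
      positivity
    · simpa [chainFunctional, chainBound] using hsmall s.1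
  · rintro (p | s)
    · simp [chainFunctional, chainBound, chainWitness]
    · have : s.1.card ≠ 0 := s.nonempty.card_ne_zero
      simp only [chainFunctional, chainBound, chainWitness, LinearMap.sum_apply,
        LinearMap.proj_apply]
      rw [Finset.sum_congr rfl fun q hq => if_pos hq]
      simp [this]
  · rintro (p | s) (q | t) hne <;>
      simp only [chainFunctional, chainBound, chainWitness, LinearMap.sum_apply,
        LinearMap.neg_apply, LinearMap.proj_apply, neg_lt_zero]
    · have hqp : q ≠ p := by rintro rfl; exact hne rfl
      rw [Function.update_of_ne hqp]
      positivity
    · refine lt_of_le_of_lt (Finset.sum_le_card_nsmul _ _ ((Nat.card P : ℝ) + 1)⁻¹ fun q _ => ?_)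
        (by simpa using hsmall t.1)
      by_cases hq : q = p
      · subst hq; rw [Function.update_self]; positivity
      · rw [Function.update_of_ne hq]
    · have : 0 < s.1.card := s.nonempty.card_pos
      split_ifs <;> positivity
    -- The chain `t` misses an element of `s`, losing weight `1/|s| ≥ 1/(n+1)` with n = |P|, while
    -- its elements outside `s`, of weight `1/(n+1)²` each, regain less than `1/(n+1)`.
    · have hst : ¬ s.1 ⊆ t.1 := fun h => hne (by rw [MaxChain.eq_of_subset h])
      rw [Finset.sum_ite, Finset.sum_const, Finset.sum_const, nsmul_eq_mul, nsmul_eq_mul]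
      have hlt : (t.1.filter (· ∈ s.1)).card + 1 ≤ s.1.card := by
        refine Finset.card_lt_card ⟨fun x hx => (Finset.mem_filter.1 hx).2, fun h => hst ?_⟩
        exact fun x hx => (Finset.mem_filter.1 (h hx)).1
      have hlt' : ((t.1.filter (· ∈ s.1)).card : ℝ) + 1 ≤ s.1.card := by exact_mod_cast hlt
      have hs0 : (0 : ℝ) < s.1.card := by exact_mod_cast s.nonempty.card_pos
      have h1 : ((t.1.filter (· ∈ s.1)).card : ℝ) * (s.1.card : ℝ)⁻¹ ≤ 1 - (s.1.card : ℝ)⁻¹ := by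
        have := mul_le_mul_of_nonneg_right hlt' (inv_nonneg.2 hs0.le)
        rw [add_mul, mul_inv_cancel₀ hs0.ne'] at this
        linarith
      have hN : (0 : ℝ) < (Nat.card P : ℝ) + 1 := by positivity
      have h2 : ((t.1.filter (· ∉ s.1)).card : ℝ) * ((Nat.card P : ℝ) + 1)⁻¹ ^ 2 <
          ((Nat.card P : ℝ) + 1)⁻¹ := by
        have := mul_lt_mul_of_pos_right (hsmall (t.1.filter (· ∉ s.1))) (inv_pos.2 hN)
        rw [one_mul] at this
        calc _ = _ := by ring
          _ < _ := this
      have h3 : ((Nat.card P : ℝ) + 1)⁻¹ ≤ (s.1.card : ℝ)⁻¹ :=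
        inv_anti₀ hs0 (by linarith [hcard s.1])
      linarith

end FacetCounts

/-! ### Recursion and duality for counts of saturated chains -/

section SaturatedChains

variable {P : Type*} [PartialOrder P]

/-- The saturated chains from `v` up to a maximal element. -/
def upChainSet (v : P) : Set (List P) :=
  {l | IsSaturatedChain l ∧ l.head? = some v ∧ ∃ m, l.getLast? = some m ∧ IsMax m}

theorem isSaturatedChain_cons_cons {a b : P} {l : List P} :
    IsSaturatedChain (a :: b :: l) ↔ a ⋖ b ∧ IsSaturatedChain (b :: l) := by
  simp [IsSaturatedChain, List.isChain_cons_cons]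

theorem mem_upChainSet_iff {v : P} {l : List P} :
    l ∈ upChainSet v ↔ (IsMax v ∧ l = [v]) ∨ ∃ w, v ⋖ w ∧ ∃ l' ∈ upChainSet w, l = v :: l' := by
  rcases l with _ | ⟨a, _ | ⟨b, l⟩⟩
  · simp [upChainSet, IsSaturatedChain]
  · simp only [upChainSet, Set.mem_ofPred_eq, IsSaturatedChain]
    constructor
    · rintro ⟨-, h, m, h1, h2⟩
      simp at h h1
      subst h h1
      exact .inl ⟨h2, rfl⟩
    · rintro (⟨h, h1⟩ | ⟨w, -, l', ⟨⟨h, -⟩, -⟩, h1⟩)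
      · simp at h1
        subst h1
        simpa using h
      · simp at h1
        exact absurd h1.2 (Ne.symm (Ne.symm h))
  · simp only [upChainSet, Set.mem_ofPred_eq, isSaturatedChain_cons_cons]
    constructor
    · rintro ⟨⟨hab, hl⟩, h, m, h1, h2⟩
      simp at h
      subst h
      exact .inr ⟨b, hab, b :: l, ⟨hl, rfl, m, by simpa using h1, h2⟩, rfl⟩
    · rintro (⟨h, h1⟩ | ⟨w, hvw, l', ⟨h, hw, m, h1, h2⟩, he⟩)
      · simp at h1
      · simp only [List.cons.injEq] at he
        obtain ⟨rfl, rfl⟩ := he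
        simp at hw
        subst hw
        exact ⟨⟨hvw, h⟩, rfl, m, by simpa using h1, h2⟩

/-- Prepending an element to the saturated chains starting at its upper covers. -/
def consUpChain (v : P) (x : Σ w : {w : P // v ⋖ w}, upChainSet w.1) : upChainSet v :=
  ⟨v :: x.2.1, mem_upChainSet_iff.2 (.inr ⟨x.1.1, x.1.2, x.2.1, x.2.2, rfl⟩)⟩

theorem consUpChain_injective (v : P) : Function.Injective (consUpChain v) := by
  rintro ⟨⟨w, hw⟩, ⟨l, hl⟩⟩ ⟨⟨w', hw'⟩, ⟨l', hl'⟩⟩ h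
  have h1 : l = l' := by simpa [consUpChain] using h
  subst h1
  have h2 : w = w' := Option.some_injective _ (hl.2.1.symm.trans hl'.2.1)
  subst h2
  rfl

theorem consUpChain_surjective {v : P} (hv : ¬ IsMax v) :
    Function.Surjective (consUpChain v) := by
  rintro ⟨l, hl⟩
  rcases mem_upChainSet_iff.1 hl with h | ⟨w, hw, l', hl', rfl⟩
  · exact absurd h.1 hv
  · exact ⟨⟨⟨w, hw⟩, ⟨l', hl'⟩⟩, rfl⟩

theorem upChainSet_of_isMax {v : P} (hv : IsMax v) : upChainSet v = {[v]} := by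
  ext l
  rw [mem_upChainSet_iff]
  constructor
  · rintro (h | ⟨w, hw, -⟩)
    · exact h.2
    · exact absurd hw.lt hv.not_lt
  · rintro rfl
    exact .inl ⟨hv, rfl⟩

instance finite_upChainSet [Finite P] (v : P) : Finite (upChainSet v) := by
  induction v using WellFoundedGT.induction with
  | ind v ih =>
    by_cases hv : IsMax v
    · rw [upChainSet_of_isMax hv]; infer_instance
    · have : ∀ w : {w : P // v ⋖ w}, Finite (upChainSet w.1) := fun w => ih w.1 w.2.lt
      exact Finite.of_surjective _ (consUpChain_surjective hv)

theorem upChains_eq_card (v : P) : upChains v = Nat.card (upChainSet v) :=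
  (Nat.card_coe_set_eq (upChainSet v)).symm

theorem upChains_of_isMax {v : P} (hv : IsMax v) : upChains v = 1 := by
  rw [upChains_eq_card, upChainSet_of_isMax hv]
  simp

-- Away from maximal elements, chains are sorted by their second element.
open Classical in
theorem upChains_of_not_isMax [Fintype P] {v : P} (hv : ¬ IsMax v) :
    upChains v = ∑ w with v ⋖ w, upChains w := by
  have : Fintype {w // v ⋖ w} := Subtype.fintype _
  rw [upChains_eq_card,
    ← Nat.card_congr (Equiv.ofBijective _ ⟨consUpChain_injective v, consUpChain_surjective hv⟩),
    Nat.card_sigma]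
  simp only [← upChains_eq_card]
  exact (Finset.sum_subtype (F := this) _ (by simp) _).symm

/-- Reversing a saturated chain gives a saturated chain of the dual order. -/
theorem isSaturatedChain_reverse_toDual {l : List P} :
    IsSaturatedChain (P := Pᵒᵈ) ((l.map OrderDual.toDual).reverse) ↔ IsSaturatedChain l := by
  simp only [IsSaturatedChain, List.isChain_reverse, ne_eq, List.reverse_eq_nil_iff,
    List.map_eq_nil_iff, List.isChain_map, toDual_covBy_toDual_iff]

/-- Reversal of lists; facts about `downChains` are obtained from those about `upChains` through
this. -/
theorem downChains_eq_upChains_toDual (v : P) :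
    downChains v = upChains (OrderDual.toDual v) := by
  unfold downChains upChains
  refine Set.ncard_congr (fun l _ => (l.map OrderDual.toDual).reverse) ?_ ?_ ?_
  · rintro l ⟨h1, h2, m, h3, h4⟩
    refine ⟨isSaturatedChain_reverse_toDual.2 h1, by simp [h2], OrderDual.toDual m, by simp [h3],
      h4⟩
  · intro l l' _ _ h
    exact List.map_injective_iff.2 OrderDual.toDual.injective (List.reverse_injective h)
  · rintro l ⟨h1, h2, m, h3, h4⟩
    obtain ⟨l, rfl⟩ : ∃ l' : List P, (l'.map OrderDual.toDual).reverse = l :=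
      ⟨(l.map OrderDual.ofDual).reverse, by simp [List.map_reverse]⟩
    refine ⟨l, ⟨isSaturatedChain_reverse_toDual.1 h1, ?_, OrderDual.ofDual m, ?_, h4⟩, rfl⟩
    · simpa using h2
    · simp only [List.getLast?_reverse, List.head?_map,
        Option.map_eq_some_iff] at h3
      obtain ⟨a, ha, rfl⟩ := h3
      exact ha

section ListFacts

theorem IsSaturatedChain.pairwise {l : List P} (h : IsSaturatedChain l) :
    l.Pairwise (· < ·) := by
  have : l.IsChain (· < ·) := h.2.imp fun _ _ => CovBy.lt
  exact this.pairwise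

theorem IsSaturatedChain.isChain {l : List P} (h : IsSaturatedChain l) {x y : P} (hx : x ∈ l)
    (hy : y ∈ l) : x ≤ y ∨ y ≤ x := by
  have h' := h.pairwise
  clear h
  induction l with
  | nil => simp at hx
  | cons a l ih =>
    rw [List.pairwise_cons] at h'
    rcases List.mem_cons.1 hx with rfl | hx' <;> rcases List.mem_cons.1 hy with rfl | hy'
    · exact .inl le_rfl
    · exact .inl (h'.1 y hy').le
    · exact .inr (h'.1 x hx').le
    · exact ih hx' hy' h'.2

theorem IsSaturatedChain.head_le {l : List P} (h : IsSaturatedChain l) {x : P} (hx : x ∈ l) :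
    l.head h.1 ≤ x := by
  cases l with
  | nil => exact absurd rfl h.1
  | cons a l =>
    rcases List.mem_cons.1 hx with rfl | hx
    · exact le_rfl
    · exact ((List.pairwise_cons.1 h.pairwise).1 x hx).le

theorem IsSaturatedChain.le_getLast {l : List P} (h : IsSaturatedChain l) {x : P} (hx : x ∈ l) :
    x ≤ l.getLast h.1 := by
  have h' := isSaturatedChain_reverse_toDual.2 h
  have := h'.head_le (x := OrderDual.toDual x) (by simpa using hx)
  simpa [List.head_reverse] using this

theorem IsSaturatedChain.exists_covBy {l : List P} (h : IsSaturatedChain l) {x : P} (hx : x ∈ l)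
    (hne : x ≠ l.getLast h.1) : ∃ y ∈ l, x ⋖ y := by
  induction l with
  | nil => exact absurd rfl h.1
  | cons a l ih =>
    cases l with
    | nil => simp at hx hne; exact absurd hx hne
    | cons b l =>
      obtain ⟨hab, hl⟩ := isSaturatedChain_cons_cons.1 h
      rcases List.mem_cons.1 hx with rfl | hx
      · exact ⟨b, by simp, hab⟩
      · obtain ⟨y, hy, hxy⟩ := ih hl hx (by simpa using hne)
        exact ⟨y, List.mem_cons_of_mem _ hy, hxy⟩

theorem IsSaturatedChain.exists_covBy' {l : List P} (h : IsSaturatedChain l) {x : P} (hx : x ∈ l)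
    (hne : x ≠ l.head h.1) : ∃ y ∈ l, y ⋖ x := by
  have h' := isSaturatedChain_reverse_toDual.2 h
  obtain ⟨y, hy, hxy⟩ := h'.exists_covBy (x := OrderDual.toDual x) (by simpa using hx)
    (by simpa [List.getLast_reverse] using hne)
  simp only [List.mem_reverse, List.mem_map] at hy
  obtain ⟨a, ha, rfl⟩ := hy
  exact ⟨a, ha, hxy.ofDual⟩

/-- A chain in which non-maximal elements are covered within the chain can be listed from any of
its elements upwards as a saturated chain. -/
theorem exists_isSaturatedChain_of_isChain [Finite P] {T : Set P} (hT : IsChain (· ≤ ·) T)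
    (hcov : ∀ v ∈ T, ∀ w ∈ T, v < w → ∃ u ∈ T, v ⋖ u) (v : P) (hv : v ∈ T) :
    ∃ l : List P, IsSaturatedChain l ∧ l.head? = some v ∧ ∀ z, z ∈ l ↔ z ∈ T ∧ v ≤ z := by
  induction v using WellFoundedGT.induction with
  | ind v ih =>
    by_cases hmax : ∃ w ∈ T, v < w
    · obtain ⟨w, hw, hvw⟩ := hmax
      obtain ⟨u, hu, hvu⟩ := hcov v hv w hw hvw
      obtain ⟨l, hl, hlu, hlm⟩ := ih u hvu.lt hu
      obtain ⟨l, rfl⟩ : ∃ l', l = u :: l' := by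
        cases l with
        | nil => simp at hlu
        | cons a l => simp at hlu; exact ⟨l, by rw [hlu]⟩
      refine ⟨v :: u :: l, isSaturatedChain_cons_cons.2 ⟨hvu, hl⟩, rfl, fun z => ?_⟩
      rw [List.mem_cons, hlm]
      constructor
      · rintro (rfl | ⟨h1, h2⟩)
        · exact ⟨hv, le_rfl⟩
        · exact ⟨h1, hvu.le.trans h2⟩
      · rintro ⟨hz, hvz⟩
        rcases hT.total hz hu with h | h
        · rcases hvu.eq_or_eq hvz h with rfl | rfl
          · exact .inl rfl
          · exact .inr ⟨hz, le_rfl⟩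
        · exact .inr ⟨hz, h⟩
    · refine ⟨[v], ⟨by simp, by simp⟩, rfl, fun z => ?_⟩
      rw [List.mem_singleton]
      constructor
      · rintro rfl
        exact ⟨hv, le_rfl⟩
      · rintro ⟨hz, hvz⟩
        by_contra hne
        exact hmax ⟨z, hz, lt_of_le_of_ne hvz (Ne.symm hne)⟩

end ListFacts

/-! ### Maximal chains as saturated chains between extremal elements -/

section MaximalChains

/-- Going up the list, `z` is either above the next element or squeezed into the current cover,
hence equal to one of its ends. -/
theorem IsSaturatedChain.mem_of_comparable {l : List P} (h : IsSaturatedChain l) {z : P}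
    (hz : ∀ x ∈ l, z ≤ x ∨ x ≤ z) (h1 : l.head h.1 ≤ z) (h2 : z ≤ l.getLast h.1) : z ∈ l := by
  induction l with
  | nil => exact absurd rfl h.1
  | cons a l ih =>
    cases l with
    | nil => simp at h1 h2 ⊢; exact le_antisymm h2 h1
    | cons b l =>
      obtain ⟨hab, hl⟩ := isSaturatedChain_cons_cons.1 h
      rcases hz b (by simp) with hb | hb
      · rcases hab.eq_or_eq h1 hb with rfl | rfl <;> simp
      · exact List.mem_cons_of_mem _ (ih hl (fun x hx => hz x (List.mem_cons_of_mem _ hx)) hb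
          (by simpa using h2))

theorem isMaxChain_of_mem_upChainSet {m : P} (hm : IsMin m) {l : List P} (hl : l ∈ upChainSet m) :
    IsMaxChain (· ≤ ·) {x | x ∈ l} := by
  obtain ⟨hs, hhead, n, hlast, hn⟩ := hl
  refine ⟨fun x hx y hy _ => hs.isChain hx hy, fun t ht hlt => ?_⟩
  refine Set.Subset.antisymm hlt fun z hz => ?_
  have hh : l.head hs.1 = m := Option.some_injective _ (by rw [← hhead, List.head?_eq_some_head])
  have hl' : l.getLast hs.1 = n :=
    Option.some_injective _ (by rw [← hlast, List.getLast?_eq_some_getLast])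
  refine hs.mem_of_comparable (fun x hx => ht.total hz (hlt hx)) ?_ ?_
  · rw [hh]
    rcases ht.total hz (hlt (a := m) (by rw [← hh]; exact List.head_mem _)) with h | h
    · exact hm h
    · exact h
  · rw [hl']
    rcases ht.total hz (hlt (a := n) (by rw [← hl']; exact List.getLast_mem _)) with h | h
    · exact h
    · exact hn h

/-- Every element comparable to all of a maximal chain belongs to it. -/
theorem IsMaxChain.mem_of_comparable {s : Set P} (hs : IsMaxChain (· ≤ ·) s) {z : P}
    (hz : ∀ x ∈ s, z ≤ x ∨ x ≤ z) : z ∈ s := by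
  rw [hs.2 (hs.isChain.insert fun b hb _ => hz b hb) (Set.subset_insert z s)]
  exact Set.mem_insert z s

theorem IsMaxChain.exists_mem_upChainSet [Finite P] [Nonempty P] {s : Set P}
    (hs : IsMaxChain (· ≤ ·) s) :
    ∃ m, IsMin m ∧ ∃ l ∈ upChainSet m, {x | x ∈ l} = s := by
  have hcov : ∀ v ∈ s, ∀ w, v < w → (∃ w ∈ s, v < w) → ∃ u ∈ s, v ⋖ u := by
    rintro v hv - - ⟨w, hw, hvw⟩
    obtain ⟨u, hu⟩ := (Set.toFinite {u | u ∈ s ∧ v < u}).exists_minimal ⟨w, hw, hvw⟩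
    -- An element strictly between `v` and the next element `u` of `s` would be comparable to all of
    -- `s`, hence in `s` by maximality.
    refine ⟨u, hu.1.1, hu.1.2, fun y hvy hyu => ?_⟩
    refine hyu.not_ge (hu.2 ⟨hs.mem_of_comparable fun x hx => ?_, hvy⟩ hyu.le)
    rcases hs.isChain.total hx hv with h | h
    · exact .inr (h.trans hvy.le)
    · rcases h.eq_or_lt with rfl | h
      · exact .inr hvy.le
      · rcases hs.isChain.total hx hu.1.1 with h' | h'
        · exact .inl (hyu.le.trans (hu.2 ⟨hx, h⟩ h'))
        · exact .inl (hyu.le.trans h')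
  obtain ⟨m, hm⟩ := (Set.toFinite s).exists_minimal (hs.nonempty_iff.1 ‹_›)
  have hle : ∀ x ∈ s, m ≤ x := fun x hx => by
    rcases hs.isChain.total hx hm.1 with h | h
    · exact hm.2 hx h
    · exact h
  obtain ⟨l, hl, hlm, hmem⟩ := exists_isSaturatedChain_of_isChain hs.isChain
    (fun v hv w hw hvw => hcov v hv w hvw ⟨w, hw, hvw⟩) m hm.1
  have hls : ∀ z, z ∈ l ↔ z ∈ s := fun z => by
    rw [hmem]
    exact ⟨fun h => h.1, fun h => ⟨h, hle z h⟩⟩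
  refine ⟨m, fun z hz => ?_, l, ⟨hl, hlm, l.getLast hl.1, List.getLast?_eq_some_getLast _,
    fun z hz => ?_⟩, Set.ext hls⟩
  · exact hle z (hs.mem_of_comparable fun x hx => .inl (hz.trans (hle x hx)))
  · exact hl.le_getLast ((hls z).2 (hs.mem_of_comparable fun x hx =>
      .inr ((hl.le_getLast ((hls x).2 hx)).trans hz)))

open Classical in
/-- The maximal chain underlying a saturated chain from a minimal to a maximal element. -/
noncomputable def toMaxChain (x : Σ m : {m : P // IsMin m}, upChainSet m.1) : MaxChain P :=
  ⟨x.2.1.toFinset, by simpa using isMaxChain_of_mem_upChainSet x.1.2 x.2.2⟩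

theorem toMaxChain_bijective [Finite P] [Nonempty P] :
    Function.Bijective (toMaxChain (P := P)) := by
  constructor
  · rintro ⟨⟨m, hm⟩, ⟨l, hl⟩⟩ ⟨⟨m', hm'⟩, ⟨l', hl'⟩⟩ h
    have h1 : (toMaxChain ⟨⟨m, hm⟩, ⟨l, hl⟩⟩).1 = (toMaxChain ⟨⟨m', hm'⟩, ⟨l', hl'⟩⟩).1 :=
      congrArg Subtype.val h
    have h2 : ∀ x, x ∈ l ↔ x ∈ l' := by simpa [toMaxChain, Finset.ext_iff] using h1
    have hperm : l.Perm l' := (List.perm_ext_iff_of_nodup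
      (hl.1.pairwise.imp fun h => h.ne) (hl'.1.pairwise.imp fun h => h.ne)).2 h2
    -- A strictly increasing list is determined by its set of entries.
    have h3 : l = l' := hperm.eq_of_pairwise (fun a b _ _ hab hba => (hab.asymm hba).elim)
      hl.1.pairwise hl'.1.pairwise
    subst h3
    have h4 : m = m' := Option.some_injective _ (hl.2.1.symm.trans hl'.2.1)
    subst h4
    rfl
  · rintro ⟨s, hs⟩
    obtain ⟨m, hm, l, hl, hls⟩ := hs.exists_mem_upChainSet
    refine ⟨⟨⟨m, hm⟩, ⟨l, hl⟩⟩, Subtype.ext (Finset.ext fun x => ?_)⟩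
    simpa [toMaxChain] using Set.ext_iff.1 hls x

open Classical in
theorem card_maxChain [Fintype P] [Nonempty P] :
    Nat.card (MaxChain P) = ∑ m : P with IsMin m, upChains m := by
  have : Fintype {m : P // IsMin m} := Subtype.fintype _
  rw [← Nat.card_congr (Equiv.ofBijective _ (toMaxChain_bijective (P := P))), Nat.card_sigma]
  simp only [← upChains_eq_card]
  exact (Finset.sum_subtype (F := this) _ (by simp) _).symm

end MaximalChains

end SaturatedChains

/-! ### The gap as a sum of local contributions, and inequalities for chain counts -/

section ChainCounts

variable {P : Type*} [PartialOrder P]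

section GapFormula

open Classical in
theorem upChains_eq_add_sum [Fintype P] (v : P) :
    (upChains v : ℤ) = (if IsMax v then 1 else 0) + ∑ w, if v ⋖ w then (upChains w : ℤ) else 0 := by
  by_cases hv : IsMax v
  · have : ∀ w, ¬ v ⋖ w := fun w hw => hv.not_lt hw.lt
    simp [upChains_of_isMax hv, hv, this]
  · rw [upChains_of_not_isMax hv]
    simp [hv, Finset.sum_filter]

/-- The number of elements covered by `v` once a new least element is added to the poset. -/
noncomputable def lowerDegree (v : P) : ℕ := by
  classical exact if IsMin v then 1 else {d | d ⋖ v}.ncard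

theorem lowerDegree_of_not_isMin {v : P} (hv : ¬ IsMin v) : lowerDegree v = {d | d ⋖ v}.ncard :=
  if_neg hv

theorem lowerDegree_of_isMin {v : P} (hv : IsMin v) : lowerDegree v = 1 :=
  if_pos hv

theorem exists_covBy_of_not_isMax [Finite P] {v : P} (hv : ¬ IsMax v) : ∃ w, v ⋖ w := by
  obtain ⟨w, hw⟩ := not_isMax_iff.1 hv
  obtain ⟨u, hu, -⟩ := exists_covBy_le_of_lt hw
  exact ⟨u, hu⟩

theorem exists_covBy_of_not_isMin [Finite P] {v : P} (hv : ¬ IsMin v) : ∃ w, w ⋖ v := by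
  obtain ⟨w, hw⟩ := not_isMin_iff.1 hv
  obtain ⟨u, -, hu⟩ := exists_le_covBy_of_lt hw
  exact ⟨u, hu⟩

theorem one_le_lowerDegree [Finite P] (v : P) : 1 ≤ lowerDegree v := by
  by_cases hv : IsMin v
  · rw [lowerDegree_of_isMin hv]
  · rw [lowerDegree_of_not_isMin hv]
    exact (Set.ncard_pos (Set.toFinite _)).2 (exists_covBy_of_not_isMin hv)

open Classical in
theorem lowerDegree_eq_add_sum [Fintype P] (v : P) :
    (lowerDegree v : ℤ) = (if IsMin v then 1 else 0) + ∑ d, if d ⋖ v then (1 : ℤ) else 0 := by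
  by_cases hv : IsMin v
  · have : ∀ w, ¬ w ⋖ v := fun w hw => hv.not_lt hw.lt
    simp [lowerDegree_of_isMin hv, hv, this]
  · rw [lowerDegree_of_not_isMin hv, Set.ncard_eq_toFinset_card']
    simp [hv]

/-- The gap as a sum of local contributions. -/
theorem gap_eq_sum [Fintype P] [Nonempty P] :
    gap P = ∑ v : P, ((upChains v : ℤ) - 1) * ((lowerDegree v : ℤ) - 1) := by
  classical
  have hcov : (Nat.card {p : P × P // p.1 ⋖ p.2} : ℤ) = ∑ v : P, ∑ d, if d ⋖ v then (1 : ℤ) else 0 := by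
    rw [Nat.card_eq_fintype_card, Fintype.card_subtype, Finset.card_filter,
      Fintype.sum_prod_type_right]
    push_cast
    rfl
  have hmin : (Nat.card {m : P // IsMin m} : ℤ) = ∑ v : P, if IsMin v then (1 : ℤ) else 0 := by
    rw [Nat.card_eq_fintype_card, Fintype.card_subtype, Finset.card_filter]
    push_cast
    rfl
  have hmax : (Nat.card {m : P // IsMax m} : ℤ) = ∑ v : P, if IsMax v then (1 : ℤ) else 0 := by
    rw [Nat.card_eq_fintype_card, Fintype.card_subtype, Finset.card_filter]
    push_cast
    rfl
  have hN : (Nat.card (MaxChain P) : ℤ) = ∑ v : P, if IsMin v then (upChains v : ℤ) else 0 := by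
    rw [card_maxChain, Finset.sum_filter]
    push_cast
    rfl
  -- Summing the recursion over all elements counts each `upChains v` once per lower cover of `v`.
  have hU : ∑ v : P, (upChains v : ℤ) = (∑ v : P, if IsMax v then (1 : ℤ) else 0) +
      ∑ v : P, (∑ d, if d ⋖ v then (1 : ℤ) else 0) * upChains v := by
    conv_lhs => rw [Finset.sum_congr rfl fun v _ => upChains_eq_add_sum v]
    rw [Finset.sum_add_distrib, Finset.sum_comm]
    simp only [Finset.sum_mul, ite_mul, one_mul, zero_mul]
  have hP : (Nat.card P : ℤ) = ∑ v : P, (1 : ℤ) := by simp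
  rw [gap, facetCount_chainPolytope, facetCount_orderPolytope, Nat.card_sum, Nat.card_sum]
  push_cast
  rw [hcov, hmin, hN, hP]
  rw [← hmax] at hU
  rw [eq_sub_of_add_eq hU.symm]
  simp only [← Finset.sum_add_distrib, ← Finset.sum_sub_distrib]
  refine Finset.sum_congr rfl fun v _ => ?_
  rw [lowerDegree_eq_add_sum]
  split_ifs <;> ring

end GapFormula

section Covers

theorem CovBy.not_le_of_ne_right {v w w' : P} (h : v ⋖ w) (h' : v ⋖ w') (hne : w ≠ w') :
    ¬ w ≤ w' :=
  fun hle => (h'.eq_or_eq h.le hle).elim h.ne' hne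

theorem CovBy.not_le_of_ne_left {v w w' : P} (h : w ⋖ v) (h' : w' ⋖ v) (hne : w ≠ w') :
    ¬ w ≤ w' :=
  fun hle => (h.eq_or_eq hle h'.le).elim (fun e => hne e.symm) h'.ne

end Covers

section UpChains

variable [Finite P]

theorem one_le_upChains (v : P) : 1 ≤ upChains v := by
  classical
  have := Fintype.ofFinite P
  induction v using WellFoundedGT.induction with
  | ind v ih =>
    by_cases hv : IsMax v
    · rw [upChains_of_isMax hv]
    · obtain ⟨w, hw⟩ := exists_covBy_of_not_isMax hv
      rw [upChains_of_not_isMax hv]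
      exact (ih w hw.lt).trans
        (Finset.single_le_sum (f := upChains) (fun _ _ => Nat.zero_le _) (by simpa using hw))

theorem CovBy.upChains_le {v w : P} (h : v ⋖ w) : upChains w ≤ upChains v := by
  classical
  have := Fintype.ofFinite P
  rw [upChains_of_not_isMax (v := v) fun hv => hv.not_lt h.lt]
  exact Finset.single_le_sum (f := upChains) (fun _ _ => Nat.zero_le _) (by simpa using h)

theorem CovBy.upChains_add_le {v w w' : P} (h : v ⋖ w) (h' : v ⋖ w') (hne : w ≠ w') :
    upChains w + upChains w' ≤ upChains v := by
  classical
  have := Fintype.ofFinite P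
  rw [upChains_of_not_isMax (v := v) fun hv => hv.not_lt h.lt, ← Finset.sum_pair hne]
  refine Finset.sum_le_sum_of_subset fun x hx => ?_
  rcases Finset.mem_insert.1 hx with rfl | hx
  · simpa using h
  · rw [Finset.mem_singleton] at hx
    subst hx
    simpa using h'

theorem upChains_antitone : Antitone (upChains (P := P)) := by
  intro v w h
  induction v using WellFoundedGT.induction with
  | ind v ih =>
    rcases h.eq_or_lt with rfl | hlt
    · exact le_rfl
    · obtain ⟨u, hu, huw⟩ := exists_covBy_le_of_lt hlt
      exact (ih u hu.lt huw).trans hu.upChains_le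

theorem upChains_eq_ncard {v : P} (hv : ¬ IsMax v) (h : ∀ w, v ⋖ w → upChains w = 1) :
    upChains v = {w | v ⋖ w}.ncard := by
  classical
  have := Fintype.ofFinite P
  rw [upChains_of_not_isMax hv, Set.ncard_eq_toFinset_card',
    Finset.sum_congr rfl fun w hw => h w (by simpa using hw)]
  simp

theorem CovBy.upChains_eq_of_unique {v w : P} (h : v ⋖ w) (huniq : ∀ u, v ⋖ u → u = w) :
    upChains v = upChains w := by
  classical
  have := Fintype.ofFinite P
  have : Finset.univ.filter (v ⋖ ·) = {w} := by
    ext u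
    simp only [Finset.mem_filter, Finset.mem_univ, true_and, Finset.mem_singleton]
    exact ⟨huniq u, fun hu => hu ▸ h⟩
  rw [upChains_of_not_isMax (v := v) fun hv => hv.not_lt h.lt, this, Finset.sum_singleton]

/-- Several maximal saturated chains start at `v` iff there are incomparable elements above it. -/
theorem two_le_upChains_iff {v : P} :
    2 ≤ upChains v ↔ ∃ d e, v < d ∧ v < e ∧ ¬ d ≤ e ∧ ¬ e ≤ d := by
  induction v using WellFoundedGT.induction with
  | ind v ih =>
    by_cases hv : IsMax v
    · rw [upChains_of_isMax hv]
      exact iff_of_false (by norm_num) fun ⟨d, e, hd, _⟩ => hv.not_lt hd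
    obtain ⟨w, hw⟩ := exists_covBy_of_not_isMax hv
    by_cases huniq : ∀ u, v ⋖ u → u = w
    -- With a single upper cover `w`, everything above `v` is at least `w`; an incomparable pair
    -- cannot contain `w`, so it lies strictly above `w`.
    · rw [hw.upChains_eq_of_unique huniq, ih w hw.lt]
      have hle : ∀ {d}, v < d → w ≤ d := fun hd => by
        obtain ⟨u, hu, hud⟩ := exists_covBy_le_of_lt hd
        exact huniq u hu ▸ hud
      constructor
      · rintro ⟨d, e, hd, he, h⟩
        exact ⟨d, e, hw.lt.trans hd, hw.lt.trans he, h⟩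
      · rintro ⟨d, e, hd, he, h1, h2⟩
        refine ⟨d, e, lt_of_le_of_ne (hle hd) ?_, lt_of_le_of_ne (hle he) ?_, h1, h2⟩
        · rintro rfl; exact h1 (hle he)
        · rintro rfl; exact h2 (hle hd)
    · push Not at huniq
      obtain ⟨u, hu, hne⟩ := huniq
      refine iff_of_true ?_ ⟨u, w, hu.lt, hw.lt, hu.not_le_of_ne_right hw hne,
        hw.not_le_of_ne_right hu hne.symm⟩
      have := hu.upChains_add_le hw hne
      have := one_le_upChains u
      have := one_le_upChains w
      omega

end UpChains

section DownChains

theorem downChains_of_isMin {v : P} (hv : IsMin v) : downChains v = 1 := by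
  rw [downChains_eq_upChains_toDual]
  exact upChains_of_isMax hv.toDual

theorem not_isMin_of_downChains {v : P} (h : 2 ≤ downChains v) : ¬ IsMin v := fun hv => by
  rw [downChains_of_isMin hv] at h
  omega

theorem not_isMax_of_upChains {v : P} (h : 2 ≤ upChains v) : ¬ IsMax v := fun hv => by
  rw [upChains_of_isMax hv] at h
  omega

variable [Finite P]

theorem one_le_downChains (v : P) : 1 ≤ downChains v := by
  rw [downChains_eq_upChains_toDual]
  exact one_le_upChains _

theorem CovBy.downChains_add_le {v w w' : P} (h : w ⋖ v) (h' : w' ⋖ v) (hne : w ≠ w') :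
    downChains w + downChains w' ≤ downChains v := by
  simp only [downChains_eq_upChains_toDual]
  exact h.toDual.upChains_add_le h'.toDual hne

theorem downChains_monotone : Monotone (downChains (P := P)) := by
  intro v w h
  simp only [downChains_eq_upChains_toDual]
  exact upChains_antitone (OrderDual.toDual_le_toDual.2 h)

theorem downChains_eq_ncard {v : P} (hv : ¬ IsMin v) (h : ∀ w, w ⋖ v → downChains w = 1) :
    downChains v = {w | w ⋖ v}.ncard := by
  simp only [downChains_eq_upChains_toDual] at h ⊢
  rw [upChains_eq_ncard (v := OrderDual.toDual v) (fun hm => hv hm.ofDual) fun w hw => h (OrderDual.ofDual w) hw.ofDual]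
  refine Set.ncard_congr (fun w _ => OrderDual.ofDual w) (fun w hw => hw.ofDual)
    (fun _ _ _ _ h => h) fun w hw => ⟨OrderDual.toDual w, hw.toDual, rfl⟩

theorem CovBy.downChains_eq_of_unique {v w : P} (h : w ⋖ v) (huniq : ∀ u, u ⋖ v → u = w) :
    downChains v = downChains w := by
  simp only [downChains_eq_upChains_toDual]
  exact h.toDual.upChains_eq_of_unique fun u hu => huniq (OrderDual.ofDual u) hu.ofDual

theorem two_le_downChains_iff {v : P} :
    2 ≤ downChains v ↔ ∃ a b, a < v ∧ b < v ∧ ¬ a ≤ b ∧ ¬ b ≤ a := by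
  rw [downChains_eq_upChains_toDual, two_le_upChains_iff]
  constructor
  · rintro ⟨d, e, hd, he, h1, h2⟩
    exact ⟨OrderDual.ofDual d, OrderDual.ofDual e, hd, he, h2, h1⟩
  · rintro ⟨d, e, hd, he, h1, h2⟩
    exact ⟨OrderDual.toDual d, OrderDual.toDual e, hd, he, h2, h1⟩

end DownChains

/-! ### Crossing elements and the three equivalent conditions -/

section Crossing

variable [Finite P]

/-- Elements with several maximal saturated chains both above and below. -/
def IsCrossing (v : P) : Prop := 2 ≤ upChains v ∧ 2 ≤ downChains v

theorem crossingNumber_eq_zero_iff {v : P} : crossingNumber v = 0 ↔ ¬ IsCrossing v := by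
  have h1 := one_le_upChains v
  have h2 := one_le_downChains v
  rw [crossingNumber, mul_eq_zero, IsCrossing]
  omega

/-- The other integer factorization, (-1)(-1), would need m = n = 0. -/
theorem sub_one_mul_sub_one_eq_one_iff {m n : ℕ} (hm : 1 ≤ m) :
    ((m : ℤ) - 1) * ((n : ℤ) - 1) = 1 ↔ m = 2 ∧ n = 2 := by
  rw [Int.mul_eq_one_iff_eq_one_or_neg_one]
  omega

theorem crossingNumber_eq_one_iff {v : P} :
    crossingNumber v = 1 ↔ upChains v = 2 ∧ downChains v = 2 :=
  sub_one_mul_sub_one_eq_one_iff (one_le_upChains v)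

theorem isCrossing_iff_exists_isXShaped {v : P} :
    IsCrossing v ↔ ∃ a b d e, IsXShaped a b v d e := by
  rw [IsCrossing, two_le_upChains_iff, two_le_downChains_iff]
  constructor
  · rintro ⟨⟨d, e, h1, h2, h3, h4⟩, a, b, h5, h6, h7, h8⟩
    exact ⟨a, b, d, e, h5, h6, h1, h2, h7, h8, h3, h4⟩
  · rintro ⟨a, b, d, e, h5, h6, h1, h2, h7, h8, h3, h4⟩
    exact ⟨⟨d, e, h1, h2, h3, h4⟩, a, b, h5, h6, h7, h8⟩

/-- A saturated chain consisting of the elements with crossing number one, all others having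
crossing number zero. -/
def IsCrossingChain (l : List P) : Prop :=
  IsSaturatedChain l ∧ (∀ v ∈ l, crossingNumber v = 1) ∧ ∀ v, v ∉ l → crossingNumber v = 0

theorem IsCrossingChain.mem {l : List P} (h : IsCrossingChain l) {v : P} (hv : IsCrossing v) :
    v ∈ l := by
  by_contra hl
  exact crossingNumber_eq_zero_iff.1 (h.2.2 v hl) hv

theorem IsCrossingChain.upChains_eq {l : List P} (h : IsCrossingChain l) {v : P} (hv : v ∈ l) :
    upChains v = 2 :=
  (crossingNumber_eq_one_iff.1 (h.2.1 v hv)).1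

theorem IsCrossingChain.downChains_eq {l : List P} (h : IsCrossingChain l) {v : P} (hv : v ∈ l) :
    downChains v = 2 :=
  (crossingNumber_eq_one_iff.1 (h.2.1 v hv)).2

/-- A lower cover of the head with several chains below it would be crossing, hence in `l` but below
its head. So each lower cover contributes exactly one chain. -/
theorem IsCrossingChain.ncard_head {l : List P} (h : IsCrossingChain l) :
    {d | d ⋖ l.head h.1.1}.ncard = 2 := by
  have hmem := List.head_mem h.1.1
  rw [← downChains_eq_ncard (not_isMin_of_downChains (h.downChains_eq hmem).ge),
    h.downChains_eq hmem]
  intro d hd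
  by_contra hne
  have h1 := one_le_downChains d
  have hc : IsCrossing d :=
    ⟨(h.upChains_eq hmem).ge.trans hd.upChains_le, by omega⟩
  exact hd.lt.not_ge (h.1.head_le (h.mem hc))

theorem IsCrossingChain.ncard_getLast {l : List P} (h : IsCrossingChain l) :
    {u | l.getLast h.1.1 ⋖ u}.ncard = 2 := by
  have hmem := List.getLast_mem h.1.1
  rw [← upChains_eq_ncard (not_isMax_of_upChains (h.upChains_eq hmem).ge), h.upChains_eq hmem]
  intro d hd
  by_contra hne
  have h1 := one_le_upChains d
  have hc : IsCrossing d :=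
    ⟨by omega, (h.downChains_eq hmem).ge.trans (downChains_monotone hd.le)⟩
  exact hd.lt.not_ge (h.1.le_getLast (h.mem hc))

theorem gap_eq_one_of_isCrossingChain {l : List P} (h : IsCrossingChain l) : gap P = 1 := by
  classical
  have := Fintype.ofFinite P
  have : Nonempty P := ⟨l.head h.1.1⟩
  have hmem := List.head_mem h.1.1
  rw [gap_eq_sum, Finset.sum_eq_single (l.head h.1.1)]
  · rw [lowerDegree_of_not_isMin (not_isMin_of_downChains (h.downChains_eq hmem).ge),
      h.ncard_head, h.upChains_eq hmem]
    norm_num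
  · intro v _ hne
    by_contra hcon
    have h1 := one_le_upChains v
    have h2 := one_le_lowerDegree v
    simp only [mul_eq_zero, not_or] at hcon
    have hmin : ¬ IsMin v := fun hv => by
      rw [lowerDegree_of_isMin hv] at hcon
      simp at hcon
    have hcard : 1 < {d | d ⋖ v}.ncard := by
      rw [← lowerDegree_of_not_isMin hmin]; omega
    obtain ⟨a, ha, b, hb, hab⟩ := (Set.one_lt_ncard (Set.toFinite _)).1 hcard
    have hpos := one_le_downChains (P := P)
    have hv : v ∈ l := h.mem ⟨by omega, by
      have := CovBy.downChains_add_le ha hb hab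
      have := hpos a
      have := hpos b
      omega⟩
    -- The predecessor in `l` already accounts for both chains below `v`; a second lower cover would
    -- give a third.
    obtain ⟨y, hy, hyv⟩ := h.1.exists_covBy' hv hne
    obtain ⟨z, hz, hzy⟩ := Set.exists_ne_of_one_lt_ncard hcard y
    have h3 := CovBy.downChains_add_le hz hyv hzy
    rw [h.downChains_eq hv, h.downChains_eq hy] at h3
    have := hpos z
    omega
  · simp

/-- Constant chain counts make the neighbour in `l` the only lower cover (except at the head) and
the only upper cover (except at the last element). Hence `a, b` lie below the head and `d, e` above
the last element, and any member of `l` can serve as center. -/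
theorem IsCrossingChain.isXOrchid {l : List P} (h : IsCrossingChain l) : IsXOrchid P := by
  refine ⟨l, h.1.1, h.1, h.ncard_getLast, h.ncard_head, fun a b c d e hX => ?_⟩
  have hc : c ∈ l := h.mem (isCrossing_iff_exists_isXShaped.2 ⟨a, b, d, e, hX⟩)
  have hdown : ∀ x ∈ l, a < x → b < x → a < l.head h.1.1 ∧ b < l.head h.1.1 := by
    intro x
    induction x using WellFoundedLT.induction with
    | ind x ih =>
      intro hx hax hbx
      by_cases hne : x = l.head h.1.1
      · exact hne ▸ ⟨hax, hbx⟩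
      obtain ⟨y, hy, hyx⟩ := h.1.exists_covBy' hx hne
      have key : ∀ {z}, z < x → z ≤ y := fun hz => by
        obtain ⟨u, hzu, hux⟩ := exists_le_covBy_of_lt hz
        by_cases huy : u = y
        · exact huy ▸ hzu
        · have h1 := CovBy.downChains_add_le hux hyx huy
          rw [h.downChains_eq hx, h.downChains_eq hy] at h1
          have := one_le_downChains u
          omega
      refine ih y hyx.lt hy (lt_of_le_of_ne (key hax) ?_) (lt_of_le_of_ne (key hbx) ?_)
      · rintro rfl; exact hX.not_ge_lower (key hbx)
      · rintro rfl; exact hX.not_le_lower (key hax)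
  have hup : ∀ x ∈ l, x < d → x < e → l.getLast h.1.1 < d ∧ l.getLast h.1.1 < e := by
    intro x
    induction x using WellFoundedGT.induction with
    | ind x ih =>
      intro hx hxd hxe
      by_cases hne : x = l.getLast h.1.1
      · exact hne ▸ ⟨hxd, hxe⟩
      obtain ⟨y, hy, hxy⟩ := h.1.exists_covBy hx hne
      have key : ∀ {z}, x < z → y ≤ z := fun hz => by
        obtain ⟨u, hxu, huz⟩ := exists_covBy_le_of_lt hz
        by_cases huy : u = y
        · exact huy ▸ huz
        · have h1 := CovBy.upChains_add_le hxu hxy huy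
          rw [h.upChains_eq hx, h.upChains_eq hy] at h1
          have := one_le_upChains u
          omega
      refine ih y hxy.lt hy (lt_of_le_of_ne (key hxd) ?_) (lt_of_le_of_ne (key hxe) ?_)
      · rintro rfl; exact hX.not_le_upper (key hxe)
      · rintro rfl; exact hX.not_ge_upper (key hxd)
  have h1 := hdown c hc hX.lt_left hX.lt_right
  have h2 := hup c hc hX.gt_left hX.gt_right
  exact ⟨hc, fun c' hc' =>
    ⟨h1.1.trans_le (h.1.head_le hc'), h1.2.trans_le (h.1.head_le hc'),
      (h.1.le_getLast hc').trans_lt h2.1, (h.1.le_getLast hc').trans_lt h2.2,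
      hX.not_le_lower, hX.not_ge_lower, hX.not_le_upper, hX.not_ge_upper⟩⟩

theorem IsXOrchid.exists_isCrossingChain (h : IsXOrchid P) : ∃ l : List P, IsCrossingChain l := by
  obtain ⟨l, hl, hs, htop, hbot, hX⟩ := h
  obtain ⟨d, e, hde, htop'⟩ := Set.ncard_eq_two.1 htop
  obtain ⟨a, b, hab, hbot'⟩ := Set.ncard_eq_two.1 hbot
  have hd : l.getLast hl ⋖ d := htop'.ge (by simp)
  have he : l.getLast hl ⋖ e := htop'.ge (by simp)
  have ha : a ⋖ l.head hl := hbot'.ge (by simp)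
  have hb : b ⋖ l.head hl := hbot'.ge (by simp)
  have hmem : ∀ v, IsCrossing v → v ∈ l := fun v hv => by
    obtain ⟨a, b, d, e, h⟩ := isCrossing_iff_exists_isXShaped.1 hv
    exact (hX _ _ _ _ _ h).1
  have hcross : ∀ v ∈ l, IsCrossing v := fun v hv =>
    isCrossing_iff_exists_isXShaped.2 ⟨a, b, d, e, ha.lt.trans_le (hs.head_le hv),
      hb.lt.trans_le (hs.head_le hv), (hs.le_getLast hv).trans_lt hd.lt,
      (hs.le_getLast hv).trans_lt he.lt, ha.not_le_of_ne_left hb hab,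
      hb.not_le_of_ne_left ha hab.symm, hd.not_le_of_ne_right he hde,
      he.not_le_of_ne_right hd hde.symm⟩
  have hup : ∀ v ∈ l, upChains v = 2 := by
    intro v
    induction v using WellFoundedGT.induction with
    | ind v ih =>
      intro hv
      by_cases hne : v = l.getLast hl
      · subst hne
        rw [upChains_eq_ncard (not_isMax_of_upChains (hcross _ hv).1), htop]
        intro w hw
        by_contra hw1
        have := one_le_upChains w
        exact hw.lt.not_ge (hs.le_getLast (hmem w
          ⟨by omega, (hcross _ hv).2.trans (downChains_monotone hw.le)⟩))
      · obtain ⟨y, hy, hvy⟩ := hs.exists_covBy hv hne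
        rw [hvy.upChains_eq_of_unique, ih y hvy.lt hy]
        intro u hu
        by_contra huy
        -- A second upper cover `u` would give an X whose center could be replaced by `y`, forcing
        -- `y < y`.
        have hX' : IsXShaped a b v y u :=
          ⟨ha.lt.trans_le (hs.head_le hv), hb.lt.trans_le (hs.head_le hv), hvy.lt, hu.lt,
            ha.not_le_of_ne_left hb hab, hb.not_le_of_ne_left ha hab.symm,
            hvy.not_le_of_ne_right hu (Ne.symm huy), hu.not_le_of_ne_right hvy huy⟩
        exact ((hX _ _ _ _ _ hX').2 y hy).gt_left.false
  have hdown : ∀ v ∈ l, downChains v = 2 := by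
    intro v
    induction v using WellFoundedLT.induction with
    | ind v ih =>
      intro hv
      by_cases hne : v = l.head hl
      · subst hne
        rw [downChains_eq_ncard (not_isMin_of_downChains (hcross _ hv).2), hbot]
        intro w hw
        by_contra hw1
        have := one_le_downChains w
        exact hw.lt.not_ge (hs.head_le (hmem w
          ⟨(hcross _ hv).1.trans hw.upChains_le, by omega⟩))
      · obtain ⟨y, hy, hyv⟩ := hs.exists_covBy' hv hne
        rw [hyv.downChains_eq_of_unique, ih y hyv.lt hy]
        intro u hu
        by_contra huy
        have hX' : IsXShaped y u v d e :=
          ⟨hyv.lt, hu.lt, (hs.le_getLast hv).trans_lt hd.lt, (hs.le_getLast hv).trans_lt he.lt,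
            hyv.not_le_of_ne_left hu (Ne.symm huy), hu.not_le_of_ne_left hyv huy,
            hd.not_le_of_ne_right he hde, he.not_le_of_ne_right hd hde.symm⟩
        exact ((hX _ _ _ _ _ hX').2 y hy).lt_left.false
  exact ⟨l, hs, fun v hv => crossingNumber_eq_one_iff.2 ⟨hup v hv, hdown v hv⟩,
    fun v hv => crossingNumber_eq_zero_iff.2 fun h => hv (hmem v h)⟩

/-- The ambient space has dimension zero, so no face has dimension one less. The general count fails
here: the empty chain is maximal but defines no facet. -/
theorem gap_of_isEmpty [IsEmpty P] : gap P = 0 := by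
  have h : ∀ K : Set (P → ℝ), facetCount K = 0 := fun K => by
    have : {F : Set (P → ℝ) | IsFacet K F} = ∅ := by
      refine Set.eq_empty_of_forall_notMem fun F hF => ?_
      have h1 := hF.2.2
      have h2 := Submodule.finrank_le (vectorSpan ℝ K)
      have h3 : Module.finrank ℝ (P → ℝ) = 0 := Module.finrank_zero_of_subsingleton
      omega
    rw [facetCount, this, Set.ncard_empty]
  rw [gap, h, h]
  rfl

/-- If the gap is one, exactly one element contributes to it. -/
theorem exists_unique_contribution (h : gap P = 1) :
    ∃ v₀ : P, upChains v₀ = 2 ∧ lowerDegree v₀ = 2 ∧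
      ∀ v, v ≠ v₀ → upChains v = 1 ∨ lowerDegree v = 1 := by
  classical
  have := Fintype.ofFinite P
  rcases isEmpty_or_nonempty P with hP | hP
  · rw [gap_of_isEmpty] at h
    exact absurd h (by norm_num)
  rw [gap_eq_sum] at h
  have hnn : ∀ v : P, 0 ≤ ((upChains v : ℤ) - 1) * ((lowerDegree v : ℤ) - 1) := fun v => by
    have h1 := one_le_upChains v
    have h2 := one_le_lowerDegree v
    exact mul_nonneg (by omega) (by omega)
  obtain ⟨v₀, -, hv₀⟩ : ∃ v ∈ (Finset.univ : Finset P),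
      ((upChains v : ℤ) - 1) * ((lowerDegree v : ℤ) - 1) ≠ 0 :=
    Finset.exists_ne_zero_of_sum_ne_zero (by rw [h]; norm_num)
  rw [← Finset.add_sum_erase _ _ (Finset.mem_univ v₀)] at h
  have hrest : 0 ≤ ∑ v ∈ Finset.univ.erase v₀,
      ((upChains v : ℤ) - 1) * ((lowerDegree v : ℤ) - 1) := Finset.sum_nonneg fun v _ => hnn v
  have hv₀' := hnn v₀
  have hone : ((upChains v₀ : ℤ) - 1) * ((lowerDegree v₀ : ℤ) - 1) = 1 := by omega
  obtain ⟨h1, h2⟩ := (sub_one_mul_sub_one_eq_one_iff (one_le_upChains v₀)).1 hone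
  refine ⟨v₀, h1, h2, fun v hv => ?_⟩
  have hzero := (Finset.sum_eq_zero_iff_of_nonneg fun v _ => hnn v).1
    (by omega : ∑ v ∈ Finset.univ.erase v₀,
      ((upChains v : ℤ) - 1) * ((lowerDegree v : ℤ) - 1) = 0) v (by simp [hv])
  rw [mul_eq_zero] at hzero
  omega

theorem exists_isCrossingChain_of_gap_eq_one (h : gap P = 1) :
    ∃ l : List P, IsCrossingChain l := by
  obtain ⟨v₀, hu₀, hd₀, hrest⟩ := exists_unique_contribution h
  have hmin₀ : ¬ IsMin v₀ := fun hv => by rw [lowerDegree_of_isMin hv] at hd₀; omega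
  -- Away from `v₀` a crossing element has lower degree 1, and its unique lower cover inherits all
  -- its chains downwards.
  have hdesc : ∀ v, IsCrossing v → v ≠ v₀ →
      ∃ d, IsCrossing d ∧ d ⋖ v ∧ ∀ d', d' ⋖ v → d' = d := by
    intro v hv hne
    have hdeg : lowerDegree v = 1 := (hrest v hne).resolve_left fun h => by
      have := hv.1
      omega
    rw [lowerDegree_of_not_isMin (not_isMin_of_downChains hv.2)] at hdeg
    obtain ⟨d, hd⟩ := Set.ncard_eq_one.1 hdeg
    have hdv : d ⋖ v := hd.ge rfl
    have huniq : ∀ d', d' ⋖ v → d' = d := fun d' hd' => hd.le hd'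
    exact ⟨d, ⟨hv.1.trans hdv.upChains_le, (hdv.downChains_eq_of_unique huniq) ▸ hv.2⟩, hdv,
      huniq⟩
  have hge : ∀ v : P, IsCrossing v → v₀ ≤ v := by
    intro v
    induction v using WellFoundedLT.induction with
    | ind v ih =>
      intro hv
      by_cases hne : v = v₀
      · exact hne.ge
      · obtain ⟨d, hd, hdv, -⟩ := hdesc v hv hne
        exact (ih d hdv.lt hd).trans hdv.le
  have hup : ∀ v, IsCrossing v → upChains v = 2 := fun v hv =>
    le_antisymm (hu₀ ▸ upChains_antitone (hge v hv)) hv.1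
  have hdown₀ : downChains v₀ = 2 := by
    rw [downChains_eq_ncard hmin₀, ← lowerDegree_of_not_isMin hmin₀, hd₀]
    intro d hd
    by_contra hne
    have := one_le_downChains d
    exact hd.lt.not_ge (hge d ⟨hu₀.ge.trans hd.upChains_le, by omega⟩)
  have hv₀ : IsCrossing v₀ := ⟨hu₀.ge, hdown₀.ge⟩
  have hdown : ∀ v : P, IsCrossing v → downChains v = 2 := by
    intro v
    induction v using WellFoundedLT.induction with
    | ind v ih =>
      intro hv
      by_cases hne : v = v₀
      · exact hne ▸ hdown₀
      · obtain ⟨d, hd, hdv, huniq⟩ := hdesc v hv hne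
        rw [hdv.downChains_eq_of_unique huniq, ih d hdv.lt hd]
  have htotal : ∀ x : P, IsCrossing x → ∀ y, IsCrossing y → x ≤ y ∨ y ≤ x := by
    intro x
    induction x using WellFoundedLT.induction with
    | ind x ih =>
      intro hx y hy
      by_cases hne : x = v₀
      · exact .inl (hne ▸ hge y hy)
      · obtain ⟨d, hd, hdx, -⟩ := hdesc x hx hne
        rcases ih d hdx.lt hd y hy with h | h
        · rcases h.eq_or_lt with rfl | hlt
          · exact .inr hdx.le
          -- If `y` were reached through a cover `u ≠ x` of `d`, then `upChains u ≥ upChains y = 2`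
          -- and `upChains x = 2` would give `upChains d ≥ 4`.
          · obtain ⟨u, hdu, huy⟩ := exists_covBy_le_of_lt hlt
            by_cases hux : u = x
            · exact .inl (hux ▸ huy)
            · have h1 := hdu.upChains_add_le hdx hux
              have h2 := upChains_antitone huy
              rw [hup x hx, hup d hd] at h1
              rw [hup y hy] at h2
              omega
        · exact .inr (h.trans hdx.le)
  have hcov : ∀ v : P, IsCrossing v → ∀ w, IsCrossing w → v < w → ∃ u, IsCrossing u ∧ v ⋖ u := by
    intro v hv w
    induction w using WellFoundedLT.induction with
    | ind w ih =>
      intro hw hvw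
      -- Descent from `w` through unique lower covers stays above `v` until it reaches it; the step
      -- before is the required cover.
      obtain ⟨d, hd, hdw, huniq⟩ := hdesc w hw ((hge v hv).trans_lt hvw).ne'
      obtain ⟨u, hvu, huw⟩ := exists_le_covBy_of_lt hvw
      rw [huniq u huw] at hvu
      rcases hvu.eq_or_lt with rfl | hlt
      · exact ⟨w, hw, hdw⟩
      · exact ih d hdw.lt hd hlt
  obtain ⟨l, hl, -, hmem⟩ := exists_isSaturatedChain_of_isChain (T := {v | IsCrossing v})
    (fun x hx y hy _ => htotal x hx y hy) hcov v₀ hv₀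
  refine ⟨l, hl, fun v hv => ?_, fun v hv => ?_⟩
  · have := ((hmem v).1 hv).1
    exact crossingNumber_eq_one_iff.2 ⟨hup v this, hdown v this⟩
  · exact crossingNumber_eq_zero_iff.2 fun h => hv ((hmem v).2 ⟨h, hge v h⟩)

end Crossing

end ChainCounts

theorem theorem3p3 (P : Type*) [PartialOrder P] [Finite P] :
    List.TFAE [
      IsXOrchid P,
      gap P = 1,
      ∃ l : List P, IsSaturatedChain l ∧
        (∀ v ∈ l, crossingNumber v = 1) ∧ (∀ v, v ∉ l → crossingNumber v = 0)] := by
  tfae_have 1 → 3 := fun h => h.exists_isCrossingChain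
  tfae_have 3 → 1 := fun ⟨_, h⟩ => IsCrossingChain.isXOrchid h
  tfae_have 2 → 3 := fun h => exists_isCrossingChain_of_gap_eq_one h
  tfae_have 3 → 2 := fun ⟨_, h⟩ => gap_eq_one_of_isCrossingChain h
  tfae_finish
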